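/- Let $n\ge 2$, $m\ge 1$, $A\in\mathbb R^{n\times m}$ with columns $c_1,\dots,c_m\in\mathbb R^n$, and let $S_n=\{x\in\mathbb R^n: x_i\ge 0,\ \sum_i x_i=1\}$. Consider the zero-sum game in which, for mixed strategies $x\in S_n$ and $y\in S_m$, Player 1 receives $x^\top A y$ and Player 2 receives $-x^\top A y$. Let $\mathcal X^*\subseteq S_n$ be the set of equilibrium strategies of Player 1, i.e. of those $x^*\in S_n$ for which there is $y^*\in S_m$ with $x^\top A y^*\le (x^*)^\top A y^*\le (x^*)^\top A y$ for all $x\in S_n$, $y\in S_m$. Let $\mu$ be the measure on $S_n$ given by $\mu(S)=\lambda_{n-1}(\{(x_1,\dots,x_{n-1}): x\in S\})$, where $\lambda_{n-1}$ is Lebesgue measure on $\mathbb R^{n-1}$, and let $\partial$ denote the boundary relative to the affine hull of $S_n$. The best-response sets are $$\mathrm{BR}_1(y)=\operatorname*{arg\,max}_{i\in[n]}\,(Ay)_i,\qquad \mathrm{BR}_2(x)=\operatorname*{arg\,min}_{j\in[m]}\,c_j^\top x ,$$ so that $\mathrm{BR}_1(0)=[n]$ and $\mathrm{BR}_2(0)=[m]$.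 Fictitious play with prior weights $k_1,k_2\ge 0$ is any sequence $(\hat x(k),\hat y(k))_{k\ge 0}$ such that $\hat x(0)\in S_n$ if $k_1>0$ and $\hat x(0)=0$ if $k_1=0$, $\hat y(0)\in S_m$ if $k_2>0$ and $\hat y(0)=0$ if $k_2=0$, and, for all $k\ge 0$, $$\hat x(k+1)=\frac{(k+k_1)\hat x(k)+e_{p_k}}{k+k_1+1},\qquad \hat y(k+1)=\frac{(k+k_2)\hat y(k)+e_{q_k}}{k+k_2+1}$$ for some $p_k\in \mathrm{BR}_1(\hat y(k))$ and $q_k\in \mathrm{BR}_2(\hat x(k))$, where ties are broken in an arbitrary way. Assume: - (A1) $\mu(\mathcal X^*)>0$; - (A2) $\partial S_n\cap\mathcal X^*=\emptyset$, i.e. every equilibrium strategy of Player 1 is fully mixed; - (A3) for every $x^*\in\partial\mathcal X^*$ there is $l\in[n]$ such that every $w\in\operatorname{conv}\{c_j : j\in \mathrm{BR}_2(x^*),\ c_j\notin\operatorname{span}\{(1,\dots,1)^\top\}\}$ satisfies $w_l<\max_{i\in[n]} w_i$. Then, if Player 1 starts with no prior ($k_1=0$), under any tie-breaking rule and for any prior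 of Player 2, the sequence $\hat x(k)$ does not converge to any point of $\mathcal X^*$. -/

import Mathlib

open Filter Topology MeasureTheory
open scoped Matrix

namespace ZeroSum

/-- `(x, y)` is a mixed Nash equilibrium of the zero-sum game in which Player 1 (rows) receives
`xᵀ A y` and Player 2 (columns) receives `-xᵀ A y`, i.e. a saddle point of `xᵀ A y`. -/
def IsNash {n m : ℕ} (A : Matrix (Fin n) (Fin m) ℝ) (x : Fin n → ℝ) (y : Fin m → ℝ) : Prop :=
  x ∈ stdSimplex ℝ (Fin n) ∧ y ∈ stdSimplex ℝ (Fin m) ∧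
    (∀ x' ∈ stdSimplex ℝ (Fin n), x' ⬝ᵥ (A *ᵥ y) ≤ x ⬝ᵥ (A *ᵥ y)) ∧
    (∀ y' ∈ stdSimplex ℝ (Fin m), x ⬝ᵥ (A *ᵥ y) ≤ x ⬝ᵥ (A *ᵥ y'))

/-- The set of equilibrium strategies of Player 1. -/
def nashSet₁ {n m : ℕ} (A : Matrix (Fin n) (Fin m) ℝ) : Set (Fin n → ℝ) :=
  {x | ∃ y, IsNash A x y}

/-- Pure best responses of Player 1 to `y` (for `y = 0` these are all actions). -/
def bestResponse₁ {n m : ℕ} (A : Matrix (Fin n) (Fin m) ℝ) (y : Fin m → ℝ) : Set (Fin n) :=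
  {i | ∀ i', (A *ᵥ y) i' ≤ (A *ᵥ y) i}

/-- Pure best responses of Player 2 to `x` (for `x = 0` these are all actions). -/
def bestResponse₂ {n m : ℕ} (A : Matrix (Fin n) (Fin m) ℝ) (x : Fin n → ℝ) : Set (Fin m) :=
  {j | ∀ j', (x ᵥ* A) j ≤ (x ᵥ* A) j'}

/-- The chart `(x₁, …, xₙ) ↦ (x₁, …, xₙ₋₁)`, a homeomorphism from the affine hull of the simplex
onto `ℝⁿ⁻¹`. -/
def dropLast (n : ℕ) (x : Fin n → ℝ) : Fin (n - 1) → ℝ :=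
  fun i => x (Fin.castLE (Nat.sub_le n 1) i)

/-- The `(n-1)`-dimensional measure on the simplex: Lebesgue measure of the image in `ℝⁿ⁻¹`. -/
noncomputable def simplexMeasure (n : ℕ) (U : Set (Fin n → ℝ)) : ENNReal :=
  volume (dropLast n '' U)

/-- The boundary of `U` relative to the affine hull of the simplex (with the subspace topology). -/
def relBoundary (n : ℕ) (U : Set (Fin n → ℝ)) : Set (Fin n → ℝ) :=
  (Subtype.val : affineSpan ℝ (stdSimplex ℝ (Fin n)) → (Fin n → ℝ)) ''
    frontier (Subtype.val ⁻¹' U)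

/-- A1: Player 1's equilibrium set has positive measure. -/
def PositiveMeasure {n m : ℕ} (A : Matrix (Fin n) (Fin m) ℝ) : Prop :=
  0 < simplexMeasure n (nashSet₁ A)

/-- A2: no equilibrium strategy of Player 1 lies on the boundary of the simplex. -/
def FullyMixed {n m : ℕ} (A : Matrix (Fin n) (Fin m) ℝ) : Prop :=
  relBoundary n (stdSimplex ℝ (Fin n)) ∩ nashSet₁ A = ∅

/-- A3: for each boundary point `x` of Player 1's equilibrium set there is a coordinate `l` which
is not maximal in any convex combination of those columns of `A` that are best responses to `x`
and are not multiples of the all-one vector. -/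
def BoundaryCondition {n m : ℕ} (A : Matrix (Fin n) (Fin m) ℝ) : Prop :=
  ∀ x ∈ relBoundary n (nashSet₁ A), ∃ l : Fin n,
    ∀ w ∈ convexHull ℝ {c : Fin n → ℝ | ∃ j ∈ bestResponse₂ A x,
        c = A.col j ∧ A.col j ∉ Submodule.span ℝ {(fun _ => 1 : Fin n → ℝ)}},
      w l < ⨆ i, w i

/-- Admissible initial data: a nonnegative weight `k`, together with a mixed strategy if `k > 0`
and the zero vector if `k = 0` (no prior). -/
def IsPrior {n : ℕ} (k : ℝ) (x₀ : Fin n → ℝ) : Prop :=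
  0 ≤ k ∧ (0 < k → x₀ ∈ stdSimplex ℝ (Fin n)) ∧ (k = 0 → x₀ = 0)

/-- `(x, y)` is a fictitious play trajectory for `A` with prior weights `k₁`, `k₂`. At every step
the actions played are some best responses; the way ties are broken is unrestricted. -/
structure IsFictitiousPlay {n m : ℕ} (A : Matrix (Fin n) (Fin m) ℝ) (k₁ k₂ : ℝ)
    (x : ℕ → Fin n → ℝ) (y : ℕ → Fin m → ℝ) : Prop where
  prior₁ : IsPrior k₁ (x 0)
  prior₂ : IsPrior k₂ (y 0)
  step : ∀ k : ℕ, ∃ p ∈ bestResponse₁ A (y k), ∃ q ∈ bestResponse₂ A (x k),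
    x (k + 1) = ((k : ℝ) + k₁ + 1)⁻¹ • (((k : ℝ) + k₁) • x k + Pi.single p 1) ∧
    y (k + 1) = ((k : ℝ) + k₂ + 1)⁻¹ • (((k : ℝ) + k₂) • y k + Pi.single q 1)

end ZeroSum

/-!
Let `v` be the value of the game and let `D k` be the payoffs of the actions of Player 1 against the
actions of Player 2 before time `k`, prior included. They accumulate by `D (k + 1) = D k + c_q`,
where `c_q` is the column played at time `k`, and Player 1 plays a maximizer of `D k`. Suppose that
`x k` tends to an equilibrium strategy `x*`. Since `x*` is fully mixed, every action of Player 1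
maximizes `D` infinitely often.

If only constant columns are played from some time on, then `D` changes only by constant vectors, so
it becomes constant itself. But at a time `k ≥ 1` at which `D k` is constant, `x k` is no
equilibrium strategy, and Player 2 answers a non-equilibrium strategy with a nonconstant column.

If nonconstant columns are played infinitely often, then one of them is a best response to `x*`, so
`x*` is on the boundary of the equilibrium set, and the condition there provides an action `l`. The
convex hull of the nonconstant best responses to `x*` is disjoint from the cone of vectors which are
maximal at `l`. A functional separating the two is driven to `-∞` along `D`, so `l` is eventually
not played.
-/

namespace ZeroSum

section ConstLine

variable {ι : Type*}

/-- The line of constant vectors, written as in the boundary condition (A3). -/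
abbrev constLine (ι : Type*) : Submodule ℝ (ι → ℝ) :=
  Submodule.span ℝ {(fun _ => 1 : ι → ℝ)}

theorem const_mem_constLine (a : ℝ) : (fun _ => a) ∈ constLine ι :=
  Submodule.mem_span_singleton.2 ⟨a, by ext; simp⟩

theorem mem_constLine_iff {c : ι → ℝ} : c ∈ constLine ι ↔ ∀ i j, c i = c j := by
  refine ⟨fun hc i j => ?_, fun h => ?_⟩
  · obtain ⟨a, rfl⟩ := Submodule.mem_span_singleton.1 hc
    rfl
  · rcases isEmpty_or_nonempty ι with _ | ⟨⟨i⟩⟩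
    · exact Subsingleton.elim (0 : ι → ℝ) c ▸ Submodule.zero_mem _
    · exact (funext fun j => h j i : c = fun _ => c i) ▸ const_mem_constLine (c i)

variable [Fintype ι] {w c : ι → ℝ} {v : ℝ}

theorem dotProduct_const_of_sum_eq_one (hw : ∑ i, w i = 1) (a : ℝ) : w ⬝ᵥ (fun _ => a) = a := by
  rw [dotProduct, ← Finset.sum_mul, hw, one_mul]

theorem le_dotProduct_of_mem_stdSimplex (hw : w ∈ stdSimplex ℝ ι) (hc : ∀ i, v ≤ c i) :
    v ≤ w ⬝ᵥ c :=
  (dotProduct_const_of_sum_eq_one hw.2 v).symm.trans_le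
    (dotProduct_le_dotProduct_of_nonneg_left hc hw.1)

theorem dotProduct_eq_of_mem_constLine {w' : ι → ℝ} (hw : ∑ i, w i = 1) (hw' : ∑ i, w' i = 1)
    (hc : c ∈ constLine ι) : w ⬝ᵥ c = w' ⬝ᵥ c := by
  obtain ⟨a, rfl⟩ := Submodule.mem_span_singleton.1 hc
  simp only [dotProduct_smul, dotProduct_const_of_sum_eq_one, hw, hw']

theorem lt_dotProduct_of_notMem_constLine (hw : ∑ i, w i = 1) (hpos : ∀ i, 0 < w i)
    (hle : ∀ i, v ≤ c i) (hc : c ∉ constLine ι) : v < w ⬝ᵥ c := by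
  obtain ⟨i, hi⟩ : ∃ i, v < c i := by
    by_contra! h
    exact hc (mem_constLine_iff.2 fun i j =>
      ((h i).antisymm (hle i)).trans ((hle j).antisymm (h j)))
  calc v = w ⬝ᵥ fun _ => v := (dotProduct_const_of_sum_eq_one hw v).symm
    _ < w ⬝ᵥ c := Finset.sum_lt_sum (fun i _ => mul_le_mul_of_nonneg_left (hle i) (hpos i).le)
      ⟨i, Finset.mem_univ i, mul_lt_mul_of_pos_left hi (hpos i)⟩

end ConstLine

section MaxCone

variable {ι : Type*} {l : ι} {w : ι → ℝ}

/-- The closed convex cone of vectors whose maximal entry is at `l`. Player 1 may play `l` exactly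
when the payoff vector lies in it. -/
def maxCone (l : ι) : ProperCone ℝ (ι → ℝ) where
  carrier := {w | ∀ i, w i ≤ w l}
  add_mem' hw hw' i := add_le_add (hw i) (hw' i)
  zero_mem' _ := le_rfl
  smul_mem' r _ hw i := mul_le_mul_of_nonneg_left (hw i) r.2
  isClosed' := by
    simp only [Set.ofPred_forall]
    exact isClosed_iInter fun i => isClosed_le (continuous_apply i) (continuous_apply l)

theorem mem_maxCone_of_mem_constLine (hw : w ∈ constLine ι) : w ∈ maxCone l :=
  fun i => (mem_constLine_iff.1 hw i l).le

theorem mem_constLine_of_forall_mem_maxCone (h : ∀ i, w ∈ maxCone i) : w ∈ constLine ι :=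
  mem_constLine_iff.2 fun i j => (h j i).antisymm (h i j)

theorem notMem_maxCone_of_lt_ciSup (h : w l < ⨆ i, w i) : w ∉ maxCone l := fun hw =>
  have : Nonempty ι := ⟨l⟩
  h.not_ge (ciSup_le hw)

end MaxCone

section Sequences

theorem tendsto_zero_of_eventually_succ_mul_eq {u : ℕ → ℝ}
    (hu : ∀ᶠ k : ℕ in atTop, ((k : ℝ) + 1) * u (k + 1) = k * u k) : Tendsto u atTop (𝓝 0) := by
  obtain ⟨K, hK⟩ := eventually_atTop.1 hu
  have hconst : ∀ k ≥ K, (k : ℝ) * u k = K * u K := by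
    intro k hk
    induction k, hk using Nat.le_induction with
    | base => rfl
    | succ k hk ih => rw [← ih, ← hK k hk, Nat.cast_succ]
  refine (tendsto_const_div_atTop_nhds_zero_nat (K * u K)).congr' ?_
  filter_upwards [eventually_ge_atTop K, eventually_ne_atTop 0] with k hk hk0
  rw [← hconst k hk, mul_div_cancel_left₀ _ (Nat.cast_ne_zero.2 hk0)]

theorem tendsto_atBot_of_frequently_succ_le_sub {g : ℕ → ℝ} {δ : ℝ} (hδ : 0 < δ)
    (hanti : ∀ᶠ k in atTop, g (k + 1) ≤ g k) (hdrop : ∃ᶠ k in atTop, g (k + 1) ≤ g k - δ) :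
    Tendsto g atTop atBot := by
  obtain ⟨K, hK⟩ := eventually_atTop.1 hanti
  have hshift : Antitone fun k => g (k + K) :=
    antitone_nat_of_succ_le fun k => by
      rw [add_right_comm]
      exact hK _ (Nat.le_add_left K k)
  rcases tendsto_atTop_of_antitone hshift with h | ⟨L, h⟩
  · exact (tendsto_add_atTop_iff_nat K).1 h
  · have hL : Tendsto g atTop (𝓝 L) := (tendsto_add_atTop_iff_nat K).1 h
    have hdiff : Tendsto (fun k => g k - g (k + 1)) atTop (𝓝 (L - L)) :=
      hL.sub ((tendsto_add_atTop_iff_nat 1).2 hL)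
    rw [sub_self] at hdiff
    obtain ⟨k, hk, hk'⟩ := (hdrop.and_eventually (hdiff.eventually_lt_const hδ)).exists
    linarith

theorem eventually_notMem_properCone {E : Type*} [AddCommGroup E] [TopologicalSpace E]
    [IsTopologicalAddGroup E] [Module ℝ E] [ContinuousSMul ℝ E] [LocallyConvexSpace ℝ E]
    {C : ProperCone ℝ E} {W : Set E} (hconv : Convex ℝ W) (hcomp : IsCompact W)
    (hdisj : Disjoint W C) {D c : ℕ → E} (hD : ∀ k, D (k + 1) = D k + c k)
    (hc : ∀ᶠ k in atTop, c k ∈ W ∨ -c k ∈ C) (hfreq : ∃ᶠ k in atTop, c k ∈ W) :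
    ∀ᶠ k in atTop, D k ∉ C := by
  obtain ⟨f, hfC, hfW⟩ := C.hyperplane_separation hconv hcomp hdisj
  obtain ⟨δ, hδ, hδW⟩ : ∃ δ > 0, ∀ w ∈ W, δ ≤ -f w :=
    hcomp.exists_forall_le' f.continuous.neg.continuousOn fun w hw => neg_pos.2 (hfW w hw)
  have hbot : Tendsto (fun k => f (D k)) atTop atBot := by
    refine tendsto_atBot_of_frequently_succ_le_sub hδ (hc.mono fun k hk => ?_)
      (hfreq.mono fun k hk => ?_)
    · have hle : f (c k) ≤ 0 := by
        rcases hk with hk | hk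
        · exact (hfW _ hk).le
        · simpa only [map_neg, Left.nonneg_neg_iff] using hfC _ hk
      rw [hD, map_add]
      linarith
    · rw [hD, map_add]
      linarith [hδW _ hk]
  filter_upwards [hbot.eventually_lt_atBot 0] with k hk hkC
  exact hk.not_ge (hfC _ hkC)

end Sequences

section RelBoundary

variable {n : ℕ}

theorem mem_affineSpan_stdSimplex {ι : Type*} [Fintype ι] {x : ι → ℝ} (hx : ∑ i, x i = 1) :
    x ∈ affineSpan ℝ (stdSimplex ℝ ι) := by
  classical
  have h := affineCombination_mem_affineSpan (k := ℝ) hx fun i => (Pi.single i 1 : ι → ℝ)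
  rw [Finset.affineCombination_eq_linear_combination _ _ _ hx, ← pi_eq_sum_univ' x] at h
  exact affineSpan_mono ℝ (Set.range_subset_iff.2 (single_mem_stdSimplex ℝ)) h

theorem mem_relBoundary_of_forall_add_smul_notMem {U : Set (Fin n → ℝ)} {x d : Fin n → ℝ}
    (hxU : x ∈ U) (hx : ∑ i, x i = 1) (hd : ∑ i, d i = 0) (hU : ∀ t : ℝ, 0 < t → x + t • d ∉ U) :
    x ∈ relBoundary n U := by
  have hmem (t : ℝ) : x + t • d ∈ affineSpan ℝ (stdSimplex ℝ (Fin n)) :=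
    mem_affineSpan_stdSimplex <| by
      simp only [Pi.add_apply, Pi.smul_apply, smul_eq_mul, Finset.sum_add_distrib,
        ← Finset.mul_sum, hx, hd, mul_zero, add_zero]
  let γ (t : ℝ) : affineSpan ℝ (stdSimplex ℝ (Fin n)) := ⟨x + t • d, hmem t⟩
  have hγ : Continuous γ := by fun_prop
  have hγ₀ : γ 0 = ⟨x, mem_affineSpan_stdSimplex hx⟩ := Subtype.ext (by simp [γ])
  refine ⟨γ 0, ⟨subset_closure (by simpa [hγ₀] using hxU), fun hint => ?_⟩, by rw [hγ₀]⟩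
  have hnear : ∀ᶠ t in 𝓝[>] (0 : ℝ), γ t ∈ Subtype.val ⁻¹' U :=
    (hγ.tendsto 0).mono_left nhdsWithin_le_nhds (mem_interior_iff_mem_nhds.1 hint)
  obtain ⟨t, htU, ht⟩ := (hnear.and self_mem_nhdsWithin).exists
  exact hU t ht htU

theorem mem_relBoundary_of_supporting {U : Set (Fin n → ℝ)} {x c : Fin n → ℝ} (hxU : x ∈ U)
    (hx : ∑ i, x i = 1) (hc : c ∉ constLine (Fin n)) (hU : ∀ z ∈ U, x ⬝ᵥ c ≤ z ⬝ᵥ c) :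
    x ∈ relBoundary n U := by
  obtain ⟨a, b, hab⟩ : ∃ a b, c a < c b := by
    by_contra! h
    exact hc (mem_constLine_iff.2 fun i j => (h j i).antisymm (h i j))
  refine mem_relBoundary_of_forall_add_smul_notMem (d := Pi.single a 1 - Pi.single b 1) hxU hx
    (by simp) fun t ht h => ?_
  have hle := hU _ h
  rw [add_dotProduct, smul_dotProduct, sub_dotProduct, single_one_dotProduct,
    single_one_dotProduct, smul_eq_mul] at hle
  linarith [mul_pos ht (sub_pos.2 hab)]

theorem mem_relBoundary_stdSimplex (hn : 2 ≤ n) {x : Fin n → ℝ} (hx : x ∈ stdSimplex ℝ (Fin n))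
    {i : Fin n} (hi : x i = 0) : x ∈ relBoundary n (stdSimplex ℝ (Fin n)) := by
  have : Nontrivial (Fin n) := Fin.nontrivial_iff_two_le.2 hn
  obtain ⟨j, hj⟩ := exists_ne i
  refine mem_relBoundary_of_supporting (c := Pi.single i 1) hx hx.2 (fun hc => ?_) fun z hz => ?_
  · simpa [hj] using mem_constLine_iff.1 hc i j
  · simpa only [dotProduct_single_one, hi] using hz.1 i

end RelBoundary

section Game

variable {n m : ℕ} {A : Matrix (Fin n) (Fin m) ℝ} {v : ℝ} {x : Fin n → ℝ} {q : Fin m}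

/-- `v` is the value of the game, encoded as the payoff at some equilibrium. -/
def IsValue (A : Matrix (Fin n) (Fin m) ℝ) (v : ℝ) : Prop :=
  ∃ x y, IsNash A x y ∧ x ⬝ᵥ (A *ᵥ y) = v

theorem exists_isValue (hx : x ∈ nashSet₁ A) : ∃ v, IsValue A v :=
  let ⟨y, hy⟩ := hx
  ⟨_, x, y, hy, rfl⟩

theorem le_dotProduct_mulVec (hx : ∀ j, v ≤ x ⬝ᵥ A.col j) {y : Fin m → ℝ}
    (hy : y ∈ stdSimplex ℝ (Fin m)) : v ≤ x ⬝ᵥ (A *ᵥ y) := by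
  rw [Matrix.dotProduct_mulVec, dotProduct_comm]
  exact le_dotProduct_of_mem_stdSimplex hy hx

theorem IsValue.mem_nashSet₁_iff (hv : IsValue A v) :
    x ∈ nashSet₁ A ↔ x ∈ stdSimplex ℝ (Fin n) ∧ ∀ j, v ≤ x ⬝ᵥ A.col j := by
  obtain ⟨x₀, y₀, ⟨hx₀, hy₀, hmax₀, hmin₀⟩, rfl⟩ := hv
  constructor
  · rintro ⟨y, hx, hy, hmax, hmin⟩
    refine ⟨hx, fun j => ?_⟩
    calc x₀ ⬝ᵥ (A *ᵥ y₀) ≤ x₀ ⬝ᵥ (A *ᵥ y) := hmin₀ y hy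
      _ ≤ x ⬝ᵥ (A *ᵥ y) := hmax x₀ hx₀
      _ ≤ x ⬝ᵥ (A *ᵥ Pi.single j 1) := hmin _ (single_mem_stdSimplex ℝ j)
      _ = x ⬝ᵥ A.col j := by rw [Matrix.mulVec_single_one]
  · rintro ⟨hx, hle⟩
    exact ⟨y₀, hx, hy₀, fun x' hx' => (hmax₀ x' hx').trans (le_dotProduct_mulVec hle hy₀),
      fun y hy => (hmax₀ x hx).trans (le_dotProduct_mulVec hle hy)⟩

theorem IsValue.dotProduct_col_le (hv : IsValue A v) (hx : x ∈ stdSimplex ℝ (Fin n))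
    (hq : q ∈ bestResponse₂ A x) : x ⬝ᵥ A.col q ≤ v := by
  obtain ⟨x₀, y₀, ⟨-, hy₀, hmax₀, -⟩, rfl⟩ := hv
  exact (le_dotProduct_mulVec hq hy₀).trans (hmax₀ x hx)

theorem IsValue.mem_nashSet₁_of_le_dotProduct_col (hv : IsValue A v)
    (hx : x ∈ stdSimplex ℝ (Fin n)) (hq : q ∈ bestResponse₂ A x) (hle : v ≤ x ⬝ᵥ A.col q) :
    x ∈ nashSet₁ A :=
  hv.mem_nashSet₁_iff.2 ⟨hx, fun j => hle.trans (hq j)⟩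

theorem IsValue.col_notMem_constLine (hv : IsValue A v) (hx : x ∈ stdSimplex ℝ (Fin n))
    (hxN : x ∉ nashSet₁ A) (hq : q ∈ bestResponse₂ A x) : A.col q ∉ constLine (Fin n) := by
  intro hc
  obtain ⟨x₀, y₀, h₀, -⟩ := id hv
  obtain ⟨hx₀, hle⟩ := hv.mem_nashSet₁_iff.1 ⟨y₀, h₀⟩
  refine hxN (hv.mem_nashSet₁_of_le_dotProduct_col hx hq ?_)
  exact (hle q).trans_eq (dotProduct_eq_of_mem_constLine hx₀.2 hx.2 hc)

theorem IsValue.mem_relBoundary_nashSet₁ (hv : IsValue A v) (hx : x ∈ nashSet₁ A)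
    (hq : q ∈ bestResponse₂ A x) (hc : A.col q ∉ constLine (Fin n)) :
    x ∈ relBoundary n (nashSet₁ A) := by
  have hxS := (hv.mem_nashSet₁_iff.1 hx).1
  exact mem_relBoundary_of_supporting hx hxS.2 hc fun z hz =>
    (hv.dotProduct_col_le hxS hq).trans ((hv.mem_nashSet₁_iff.1 hz).2 q)

theorem FullyMixed.pos (hA : FullyMixed A) (hn : 2 ≤ n) (hx : x ∈ nashSet₁ A) (i : Fin n) :
    0 < x i := by
  obtain ⟨y, hy⟩ := id hx
  refine (hy.1.1 i).lt_of_ne' fun hi => ?_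
  exact Set.eq_empty_iff_forall_notMem.1 hA x ⟨mem_relBoundary_stdSimplex hn hy.1 hi, hx⟩

theorem FullyMixed.single_notMem_nashSet₁ (hA : FullyMixed A) (hn : 2 ≤ n) (i : Fin n) :
    Pi.single i 1 ∉ nashSet₁ A := by
  have : Nontrivial (Fin n) := Fin.nontrivial_iff_two_le.2 hn
  obtain ⟨j, hj⟩ := exists_ne i
  exact fun h => (hA.pos hn h j).ne' (Pi.single_eq_of_ne hj 1)

theorem FullyMixed.exists_col_apply_lt (hA : FullyMixed A) (hn : 2 ≤ n) (hv : IsValue A v)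
    (hx : x ∈ stdSimplex ℝ (Fin n)) (hq : q ∈ bestResponse₂ A x)
    (hc : A.col q ∉ constLine (Fin n)) : ∃ i, A.col q i < v := by
  by_contra! hle
  have hxN : x ∈ nashSet₁ A :=
    hv.mem_nashSet₁_of_le_dotProduct_col hx hq (le_dotProduct_of_mem_stdSimplex hx hle)
  exact (lt_dotProduct_of_notMem_constLine hx.2 (hA.pos hn hxN) hle hc).not_ge
    (hv.dotProduct_col_le hx hq)

theorem eventually_bestResponse₂_subset (A : Matrix (Fin n) (Fin m) ℝ) (x : Fin n → ℝ) :
    ∀ᶠ z in 𝓝 x, bestResponse₂ A z ⊆ bestResponse₂ A x := by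
  have hcont (j : Fin m) : Continuous fun z : Fin n → ℝ => (z ᵥ* A) j := by fun_prop
  have hlt : ∀ᶠ z in 𝓝 x, ∀ j j', (x ᵥ* A) j' < (x ᵥ* A) j → (z ᵥ* A) j' < (z ᵥ* A) j := by
    simp only [eventually_all]
    exact fun j j' h => (hcont j').continuousAt.eventually_lt (hcont j).continuousAt h
  filter_upwards [hlt] with z hz j hj j'
  exact le_of_not_gt fun h => (hz j j' h).not_ge (hj j')

/-- The columns whose convex hull enters the boundary condition (A3) at `x`. -/
def nonconstBestColumns (A : Matrix (Fin n) (Fin m) ℝ) (x : Fin n → ℝ) : Set (Fin n → ℝ) :=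
  {c | ∃ j ∈ bestResponse₂ A x, c = A.col j ∧ A.col j ∉ constLine (Fin n)}

theorem finite_nonconstBestColumns (A : Matrix (Fin n) (Fin m) ℝ) (x : Fin n → ℝ) :
    (nonconstBestColumns A x).Finite :=
  (Set.finite_range A.col).subset fun _ ⟨j, _, hc, _⟩ => ⟨j, hc.symm⟩

end Game

/-- A run of fictitious play without prior of Player 1: `p` and `q` are the actions played, `x` are
the empirical frequencies of `p`, and `D` are the payoffs of Player 1's actions, accumulated
instead of averaged so that each step adds a column of `A`. The initial payoffs `D 0` stand for the
prior of Player 2. -/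
structure IsRun {n m : ℕ} (A : Matrix (Fin n) (Fin m) ℝ) (p : ℕ → Fin n) (q : ℕ → Fin m)
    (x D : ℕ → Fin n → ℝ) : Prop where
  payoff_mem_maxCone : ∀ k, D k ∈ maxCone (p k)
  mem_bestResponse₂ : ∀ k, q k ∈ bestResponse₂ A (x k)
  succ_smul : ∀ k : ℕ, ((k : ℝ) + 1) • x (k + 1) = (k : ℝ) • x k + Pi.single (p k) 1
  payoff_succ : ∀ k, D (k + 1) = D k + A.col (q k)

theorem IsFictitiousPlay.exists_isRun {n m : ℕ} {A : Matrix (Fin n) (Fin m) ℝ} {k₂ : ℝ}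
    {x : ℕ → Fin n → ℝ} {y : ℕ → Fin m → ℝ} (h : IsFictitiousPlay A 0 k₂ x y) :
    ∃ p q D, IsRun A p q x D := by
  have hk₂ : 0 ≤ k₂ := h.prior₂.1
  choose p hp q hq hx hy using h.step
  refine ⟨p, q, fun k => ((k : ℝ) + k₂) • (A *ᵥ y k), fun k i => ?_, hq, fun k => ?_, fun k => ?_⟩
  · exact mul_le_mul_of_nonneg_left (hp k i) (by positivity)
  · rw [hx k, add_zero, smul_inv_smul₀ (by positivity)]
  · rw [hy k, Matrix.mulVec_smul, Matrix.mulVec_add, Matrix.mulVec_smul,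
      Matrix.mulVec_single_one, Nat.cast_succ, add_right_comm, smul_inv_smul₀ (by positivity)]

namespace IsRun

variable {n m : ℕ} {A : Matrix (Fin n) (Fin m) ℝ} {p : ℕ → Fin n} {q : ℕ → Fin m}
  {x D : ℕ → Fin n → ℝ} {v : ℝ} {xstar : Fin n → ℝ}

theorem one_eq_single (h : IsRun A p q x D) : x 1 = Pi.single (p 0) 1 := by
  simpa using h.succ_smul 0

theorem succ_mem_stdSimplex (h : IsRun A p q x D) (k : ℕ) :
    x (k + 1) ∈ stdSimplex ℝ (Fin n) := by
  induction k with
  | zero => exact h.one_eq_single ▸ single_mem_stdSimplex ℝ (p 0)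
  | succ k ih =>
    have hstep := h.succ_smul (k + 1)
    rw [← eq_inv_smul_iff₀ (by positivity), smul_add, smul_smul] at hstep
    rw [hstep]
    refine convex_stdSimplex ℝ (Fin n) ih (single_mem_stdSimplex ℝ _) (by positivity)
      (by positivity) ?_
    field_simp

theorem frequently_eq (h : IsRun A p q x D) (hlim : Tendsto x atTop (𝓝 xstar)) {i : Fin n}
    (hi : 0 < xstar i) : ∃ᶠ k in atTop, p k = i := by
  intro hne
  refine hi.ne' (tendsto_nhds_unique (tendsto_pi_nhds.1 hlim i)
    (tendsto_zero_of_eventually_succ_mul_eq (hne.mono fun k hk => ?_)))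
  simpa only [Pi.smul_apply, Pi.add_apply, smul_eq_mul, Pi.single_eq_of_ne' hk, add_zero] using
    congrFun (h.succ_smul k) i

theorem notMem_nashSet₁_of_payoff_mem_constLine (h : IsRun A p q x D) (hn : 2 ≤ n)
    (hA : FullyMixed A) (hv : IsValue A v) {k : ℕ} (hD : D (k + 1) ∈ constLine (Fin n)) :
    x (k + 1) ∉ nashSet₁ A := by
  induction k with
  | zero => exact h.one_eq_single ▸ hA.single_notMem_nashSet₁ hn (p 0)
  | succ k ih =>
    have hxS := h.succ_mem_stdSimplex k
    have hq := h.mem_bestResponse₂ (k + 1)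
    rw [h.payoff_succ (k + 1)] at hD
    have hc : A.col (q (k + 1)) ∉ constLine (Fin n) := fun hc =>
      hv.col_notMem_constLine hxS (ih ((Submodule.add_mem_iff_left _ hc).1 hD)) hq hc
    obtain ⟨i, hi⟩ := hA.exists_col_apply_lt hn hv hxS hq hc
    -- As `D + c` is constant, the maximizer `p` of `D` minimizes the column `c` just played.
    have hp : A.col (q (k + 1)) (p (k + 1)) < v := by
      have hsum := mem_constLine_iff.1 hD i (p (k + 1))
      have hmax := h.payoff_mem_maxCone (k + 1) i
      simp only [Pi.add_apply] at hsum
      linarith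
    have hpayoff := congrArg (· ⬝ᵥ A.col (q (k + 1))) (h.succ_smul (k + 1))
    simp only [smul_dotProduct, add_dotProduct, single_one_dotProduct, smul_eq_mul] at hpayoff
    have hlt : (((k + 1 : ℕ) : ℝ) + 1) * (x (k + 2) ⬝ᵥ A.col (q (k + 1)))
        < (((k + 1 : ℕ) : ℝ) + 1) * v := by
      rw [hpayoff, add_one_mul]
      exact add_lt_add_of_le_of_lt
        (mul_le_mul_of_nonneg_left (hv.dotProduct_col_le hxS hq) (Nat.cast_nonneg _)) hp
    exact fun hN => (lt_of_mul_lt_mul_left hlt (by positivity)).not_ge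
      ((hv.mem_nashSet₁_iff.1 hN).2 _)

theorem eventually_payoff_mem_constLine (h : IsRun A p q x D)
    (hplayed : ∀ i, ∃ᶠ k in atTop, p k = i)
    (hcol : ∀ᶠ k in atTop, A.col (q k) ∈ constLine (Fin n)) :
    ∀ᶠ k in atTop, D k ∈ constLine (Fin n) := by
  obtain ⟨K, hK⟩ := eventually_atTop.1 hcol
  have hdiff : ∀ k ≥ K, D k - D K ∈ constLine (Fin n) := by
    intro k hk
    induction k, hk using Nat.le_induction with
    | base => simp only [sub_self, Submodule.zero_mem]
    | succ k hk ih =>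
      rw [h.payoff_succ, add_sub_right_comm]
      exact Submodule.add_mem _ ih (hK k hk)
  have hDK : D K ∈ constLine (Fin n) := by
    refine mem_constLine_of_forall_mem_maxCone fun i => ?_
    obtain ⟨k, hk, rfl⟩ := frequently_atTop.1 (hplayed i) K
    have hback : D K - D k ∈ maxCone (p k) :=
      mem_maxCone_of_mem_constLine (neg_sub (D k) (D K) ▸ Submodule.neg_mem _ (hdiff k hk))
    simpa only [add_sub_cancel] using add_mem (h.payoff_mem_maxCone k) hback
  filter_upwards [eventually_ge_atTop K] with k hk
  exact (Submodule.sub_mem_iff_left _ hDK).1 (hdiff k hk)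

theorem frequently_col_notMem_constLine (h : IsRun A p q x D) (hn : 2 ≤ n) (hA : FullyMixed A)
    (hv : IsValue A v) (hplayed : ∀ i, ∃ᶠ k in atTop, p k = i) :
    ∃ᶠ k in atTop, A.col (q k) ∉ constLine (Fin n) := by
  by_contra hcol
  simp only [not_frequently, not_not] at hcol
  have hD := h.eventually_payoff_mem_constLine hplayed hcol
  obtain ⟨k, hkD, hkcol⟩ := ((tendsto_add_atTop_nat 1).eventually (hD.and hcol)).exists
  exact hv.col_notMem_constLine (h.succ_mem_stdSimplex k)
    (h.notMem_nashSet₁_of_payoff_mem_constLine hn hA hv hkD) (h.mem_bestResponse₂ (k + 1)) hkcol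

theorem eventually_mem_bestResponse₂ (h : IsRun A p q x D) (hlim : Tendsto x atTop (𝓝 xstar)) :
    ∀ᶠ k in atTop, q k ∈ bestResponse₂ A xstar :=
  (hlim.eventually (eventually_bestResponse₂_subset A xstar)).mono fun k hk =>
    hk (h.mem_bestResponse₂ k)

theorem eventually_ne_of_disjoint (h : IsRun A p q x D) (hlim : Tendsto x atTop (𝓝 xstar))
    (hcol : ∃ᶠ k in atTop, A.col (q k) ∉ constLine (Fin n)) {l : Fin n}
    (hdisj : Disjoint (convexHull ℝ (nonconstBestColumns A xstar)) (maxCone l)) :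
    ∀ᶠ k in atTop, p k ≠ l := by
  have hmem : ∀ᶠ k in atTop, A.col (q k) ∉ constLine (Fin n) →
      A.col (q k) ∈ convexHull ℝ (nonconstBestColumns A xstar) :=
    (h.eventually_mem_bestResponse₂ hlim).mono fun k hk hc =>
      subset_convexHull ℝ _ ⟨q k, hk, rfl, hc⟩
  have hD : ∀ᶠ k in atTop, D k ∉ maxCone l := by
    refine eventually_notMem_properCone (convex_convexHull ℝ _)
      ((finite_nonconstBestColumns A xstar).isCompact_convexHull ℝ) hdisj h.payoff_succ
      (hmem.mono fun k hk => ?_) ((hcol.and_eventually hmem).mono fun k hk => hk.2 hk.1)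
    by_cases hc : A.col (q k) ∈ constLine (Fin n)
    · exact Or.inr (mem_maxCone_of_mem_constLine (Submodule.neg_mem _ hc))
    · exact Or.inl (hk hc)
  exact hD.mono fun k hk hp => hk (hp ▸ h.payoff_mem_maxCone k)

end IsRun

end ZeroSum

open ZeroSum in
theorem mainTheorem1_general {n m : ℕ} (hn : 2 ≤ n) {A : Matrix (Fin n) (Fin m) ℝ}
    (hA2 : FullyMixed A) {k₂ : ℝ} {x : ℕ → Fin n → ℝ} {y : ℕ → Fin m → ℝ}
    (hxy : IsFictitiousPlay A 0 k₂ x y) {xstar : Fin n → ℝ} (hxstar : xstar ∈ nashSet₁ A)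
    (hA3 : xstar ∈ relBoundary n (nashSet₁ A) →
      ∃ l, ∀ w ∈ convexHull ℝ (nonconstBestColumns A xstar), w l < ⨆ i, w i) :
    ¬ Tendsto x atTop (𝓝 xstar) := by
  intro hlim
  obtain ⟨p, q, D, hrun⟩ := hxy.exists_isRun
  obtain ⟨v, hv⟩ := exists_isValue hxstar
  have hplayed (i : Fin n) : ∃ᶠ k in atTop, p k = i :=
    hrun.frequently_eq hlim (hA2.pos hn hxstar i)
  have hcol : ∃ᶠ k in atTop, A.col (q k) ∉ constLine (Fin n) :=
    hrun.frequently_col_notMem_constLine hn hA2 hv hplayed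
  obtain ⟨k, hkcol, hkBR⟩ := (hcol.and_eventually (hrun.eventually_mem_bestResponse₂ hlim)).exists
  obtain ⟨l, hl⟩ := hA3 (hv.mem_relBoundary_nashSet₁ hxstar hkBR hkcol)
  have hdisj : Disjoint (convexHull ℝ (nonconstBestColumns A xstar)) (maxCone l) :=
    Set.disjoint_left.2 fun w hw => notMem_maxCone_of_lt_ciSup (hl w hw)
  exact hplayed l (hrun.eventually_ne_of_disjoint hlim hcol hdisj)

theorem mainTheorem1 {n m : ℕ} (hn : 2 ≤ n) (A : Matrix (Fin n) (Fin m) ℝ)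
    (hA1 : ZeroSum.PositiveMeasure A) (hA2 : ZeroSum.FullyMixed A)
    (hA3 : ZeroSum.BoundaryCondition A)
    (k₁ k₂ : ℝ) (hk₁ : k₁ = 0)
    (x : ℕ → Fin n → ℝ) (y : ℕ → Fin m → ℝ) (hxy : ZeroSum.IsFictitiousPlay A k₁ k₂ x y) :
    ∀ xstar ∈ ZeroSum.nashSet₁ A, ¬ Tendsto x atTop (𝓝 xstar) := by
  subst hk₁
  exact fun xstar hxstar => mainTheorem1_general hn hA2 hxy hxstar (hA3 xstar)
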